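/- **Theorem 2.** Let $\mu(0),\mu(1)\in(0,1)$ with $\mu(0)+\mu(1)=1$, and let $q(a,b)\in(0,1)$, $a,b\in\{0,1\}$, with $q(0,1)=q(1,0)$. Let $\{A_\ell(u):\ u,\ell=1,2,\ldots\}$ be i.i.d. $\{0,1\}$-valued random variables with $\mathbb{P}[A_\ell(u)=a]=\mu(a)$, and, independently of them, let $\{U(u,v):\ 1\le u<v\}$ be i.i.d. random variables uniformly distributed on $(0,1)$; put $U(v,u)=U(u,v)$. For positive integers $n$ and $L$, the homogeneous binary multiplicative attribute graph $\mathbb{M}(n;L)$ is the random graph on the nodes $1,\ldots,n$ in which distinct nodes $u$ and $v$ are adjacent if and only if $$U(u,v)\le\prod_{\ell=1}^{L}q\big(A_\ell(u),A_\ell(v)\big).$$ Write $\Gamma(a)=\mathbb{E}[q(a,A)]=\mu(0)q(a,0)+\mu(1)q(a,1)$ for $a\in\{0,1\}$, where $A$ has pmf $\mu$, and $$G(\nu,\mu)=\left(\frac{\mu}{\nu}\right)^{\nu}\left(\frac{1-\mu}{1-\nu}\right)^{1-\nu},\qquad 0<\nu,\mu<1 .$$ Assume $\Gamma(0)<\Gamma(1)$,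 $\rho>0$ and $1+\rho\ln\mu(0)<0$. Then the equation $1+\rho\ln G(\nu,\mu(1))=0$ has a unique solution $\nu_\star(\rho)$ in the interval $(0,\mu(1))$, and for every $\rho$-admissible scaling, that is, every sequence $(L_n)_{n\ge1}$ of positive integers with $L_n\sim\rho\ln n$ as $n\to\infty$, $$\lim_{n\to\infty}\mathbb{P}\big[\mathbb{M}(n;L_n)\text{ contains no isolated nodes}\big]=\begin{cases}0&\text{if }1+\rho\ln\big(\Gamma(1)^{\nu_\star(\rho)}\Gamma(0)^{1-\nu_\star(\rho)}\big)<0,\\[2pt]1&\text{if }1+\rho\ln\big(\Gamma(1)^{\nu_\star(\rho)}\Gamma(0)^{1-\nu_\star(\rho)}\big)>0.\end{cases}$$ -/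

import Mathlib

open MeasureTheory ProbabilityTheory Filter Topology Asymptotics

noncomputable section

namespace MAG

/-- The fixed building blocks of a homogeneous binary multiplicative attribute graph model: a
nondegenerate pmf `μ = (μ 0, μ 1)` on `{0, 1}`, and a symmetric `2 × 2` matrix `q` with all its
entries in the open interval `(0, 1)`. -/
structure Params where
  /-- the pmf of an attribute -/
  μ : Fin 2 → ℝ
  /-- the affinity matrix -/
  q : Fin 2 → Fin 2 → ℝ
  μ_mem : ∀ a, μ a ∈ Set.Ioo (0 : ℝ) 1
  μ_sum : μ 0 + μ 1 = 1
  q_symm : ∀ a b, q a b = q b a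
  q_mem : ∀ a b, q a b ∈ Set.Ioo (0 : ℝ) 1

/-- The law on `{0, 1}` of a generic attribute `A`: `P[A = a] = μ a`. -/
def Params.attrLaw (p : Params) : Measure (Fin 2) :=
  ∑ a : Fin 2, ENNReal.ofReal (p.μ a) • Measure.dirac a

/-- `Γ(a) = E[q(a, A)]`, where `A` is a generic attribute. -/
def Params.Γ (p : Params) (a : Fin 2) : ℝ := ∫ b, p.q a b ∂p.attrLaw

/-- `Q_L(a, b) = ∏_{ℓ = 1}^{L} q(a_ℓ, b_ℓ)` for attribute vectors `a, b ∈ {0, 1}^L`. -/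
def Params.Q (p : Params) {L : ℕ} (a b : Fin L → Fin 2) : ℝ := ∏ l, p.q (a l) (b l)

/-- The standing assumptions on the underlying random variables. Nodes and attributes are labelled
by `0, 1, 2, …`; `A u l` is attribute `l` of node `u`, and `U u v` is used only for `u < v`.
The attributes are i.i.d. with law `attrLaw`, the variables `U u v` (`u < v`) are i.i.d. and
uniform on `(0, 1)`, and the two collections are independent of each other. -/
structure IsSample (p : Params) {Ω : Type*} [MeasurableSpace Ω] (P : Measure Ω)
    (A : ℕ → ℕ → Ω → Fin 2) (U : ℕ → ℕ → Ω → ℝ) : Prop where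
  measurable_A : ∀ u l, Measurable (A u l)
  measurable_U : ∀ u v, u < v → Measurable (U u v)
  indep_collections :
    IndepFun (fun ω (i : ℕ × ℕ) => A i.1 i.2 ω)
      (fun ω (e : {e : ℕ × ℕ // e.1 < e.2}) => U e.1.1 e.1.2 ω) P
  iIndep_U : iIndepFun (fun e : {e : ℕ × ℕ // e.1 < e.2} => U e.1.1 e.1.2) P
  uniform_U : ∀ u v, u < v → pdf.IsUniform (U u v) (Set.Ioo (0 : ℝ) 1) P volume
  iIndep_A : iIndepFun (fun i : ℕ × ℕ => A i.1 i.2) P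
  law_A : ∀ u l, HasLaw (A u l) p.attrLaw P

section Graph

variable {Ω : Type*}

/-- The attribute vector `A_L(u) = (A_1(u), …, A_L(u))` of node `u`. -/
def attrVec (A : ℕ → ℕ → Ω → Fin 2) (L u : ℕ) (ω : Ω) : Fin L → Fin 2 := fun l => A u l ω

/-- The extension of the triangular array `U u v`, `u < v`, to all pairs by
`U(v, u) = U(u, v)` and `U(u, u) = 1`. -/
def extU (U : ℕ → ℕ → Ω → ℝ) (u v : ℕ) (ω : Ω) : ℝ :=
  if u < v then U u v ω else if v < u then U v u ω else 1

/-- Node `u` is `L`-adjacent to node `v`. -/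
def LAdj (p : Params) (A : ℕ → ℕ → Ω → Fin 2) (U : ℕ → ℕ → Ω → ℝ) (L u v : ℕ) (ω : Ω) : Prop :=
  extU U u v ω ≤ p.Q (attrVec A L u ω) (attrVec A L v ω)

theorem extU_comm (U : ℕ → ℕ → Ω → ℝ) (u v : ℕ) (ω : Ω) : extU U u v ω = extU U v u ω := by
  unfold extU
  rcases lt_trichotomy u v with h | h | h
  · simp [h, h.not_gt]
  · simp [h]
  · simp [h, h.not_gt]

theorem LAdj_symm {p : Params} {A : ℕ → ℕ → Ω → Fin 2} {U : ℕ → ℕ → Ω → ℝ} {L u v : ℕ} {ω : Ω}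
    (h : LAdj p A U L u v ω) : LAdj p A U L v u ω := by
  unfold LAdj Params.Q at *
  rw [extU_comm]
  simpa only [p.q_symm] using h

/-- The random graph `M(n; L)` on the first `n` nodes. -/
def graph (p : Params) (A : ℕ → ℕ → Ω → Fin 2) (U : ℕ → ℕ → Ω → ℝ) (n L : ℕ) (ω : Ω) :
    SimpleGraph (Fin n) where
  Adj u v := u ≠ v ∧ LAdj p A U L u v ω
  symm := ⟨fun _ _ h => ⟨h.1.symm, LAdj_symm h.2⟩⟩
  loopless := ⟨fun _ h => h.1 rfl⟩

/-- The event that `M(n; L)` contains no isolated nodes. -/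
def noIsolated (p : Params) (A : ℕ → ℕ → Ω → Fin 2) (U : ℕ → ℕ → Ω → ℝ) (n L : ℕ) : Set Ω :=
  {ω | ∀ u, ¬ (graph p A U n L ω).IsIsolated u}

end Graph

/-- A scaling `n ↦ L n` (positive integers to positive integers; the value at `0` is irrelevant)
is `ρ`-admissible if `L n ∼ ρ ln n` as `n → ∞`. -/
structure IsAdmissible (ρ : ℝ) (L : ℕ → ℕ) : Prop where
  pos : ∀ n, 1 ≤ n → 1 ≤ L n
  equiv : (fun n : ℕ => (L n : ℝ)) ~[atTop] fun n : ℕ => ρ * Real.log n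

/-- `G(ν, μ) = (μ / ν) ^ ν * ((1 - μ) / (1 - ν)) ^ (1 - ν)` for `0 < ν, μ < 1`. -/
def G (ν μ : ℝ) : ℝ := (μ / ν) ^ ν * ((1 - μ) / (1 - ν)) ^ (1 - ν)

/-- `ν` is a solution in `(0, μ(1))` of the equation `1 + ρ ln G(ν, μ(1)) = 0`. -/
def IsNuStar (p : Params) (ρ ν : ℝ) : Prop :=
  ν ∈ Set.Ioo 0 (p.μ 1) ∧ 1 + ρ * Real.log (G ν (p.μ 1)) = 0

end MAG

end

/-! Given that its attribute vector has `k` ones, a node is isolated with probability `(1 - Γ(1)^k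
Γ(0)^(L-k))^(n-1)`. As `Γ(0) < Γ(1)`, the nodes with few ones are the ones at risk. By large
deviations, for `z < μ(1)`, the expected number of nodes with at most `zL` ones is `n^(1 + ρ ln G(z,
μ(1)) + o(1))`, so the smallest fraction of ones occurring among the `n` nodes is about `ν⋆`. Such a
node has mean degree `n^(1 + ρ ln(Γ(1)^ν⋆ Γ(0)^(1-ν⋆)) + o(1))`, and the sign of this exponent
decides.

One-law (`one_sub_noIsolated_le_exp`): for `z` slightly below `ν⋆`, with high probability every node
has more than `zL` ones, hence a mean degree that is a positive power of `n`; a union bound over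
nodes finishes.

Zero-law (`noIsolated_le`): for `z` slightly above `ν⋆`, no second moment is needed. One inspects
only the first `m` nodes, with `m` large enough for one of them to have at most `zL` ones, yet small
enough for the expected number of neighbours of all such nodes to vanish. The lower tail bound
`eventually_exp_div_two_le_sum` shows that `m ≤ n` is possible. -/

namespace MAG

/-! ### Weights of attribute vectors and mean affinities -/

theorem Params.Γ_eq (p : Params) (a : Fin 2) : p.Γ a = ∑ b, p.μ b * p.q a b := by
  have h : ∀ b, 0 ≤ p.μ b := fun b => (p.μ_mem b).1.le
  unfold Params.Γ Params.attrLaw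
  rw [integral_finsetSum_measure fun i _ => Integrable.smul_measure (integrable_dirac (by simp)) (by simp)]
  simp [integral_smul_measure, h]

theorem Params.Γ_mem (p : Params) (a : Fin 2) : p.Γ a ∈ Set.Ioo (0 : ℝ) 1 := by
  rw [p.Γ_eq, Fin.sum_univ_two]
  obtain ⟨⟨h0, -⟩, ⟨h1, -⟩, hs⟩ := (⟨p.μ_mem 0, p.μ_mem 1, p.μ_sum⟩ : _ ∧ _ ∧ _)
  have q0 := p.q_mem a 0
  have q1 := p.q_mem a 1
  constructor
  · have := mul_pos h0 q0.1
    have := mul_pos h1 q1.1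
    linarith
  · have := mul_lt_mul_of_pos_left q0.2 h0
    have := mul_lt_mul_of_pos_left q1.2 h1
    linarith

theorem Params.Q_mem (p : Params) {L : ℕ} (a b : Fin L → Fin 2) : p.Q a b ∈ Set.Icc (0 : ℝ) 1 :=
  ⟨Finset.prod_nonneg fun _ _ => (p.q_mem _ _).1.le,
    Finset.prod_le_one (fun _ _ => (p.q_mem _ _).1.le) fun _ _ => (p.q_mem _ _).2.le⟩

/-- The product weight `∏ l, c (a l)` of an attribute vector. -/
noncomputable def prodWeight (c : Fin 2 → ℝ) {L : ℕ} (a : Fin L → Fin 2) : ℝ := ∏ l, c (a l)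

theorem prodWeight_nonneg {c : Fin 2 → ℝ} (hc : ∀ i, 0 ≤ c i) {L : ℕ} (a : Fin L → Fin 2) :
    0 ≤ prodWeight c a := Finset.prod_nonneg fun _ _ => hc _

theorem sum_prodWeight (c : Fin 2 → ℝ) (L : ℕ) :
    ∑ a : Fin L → Fin 2, prodWeight c a = (∑ i, c i) ^ L := (Fintype.sum_pow c L).symm

theorem Params.sum_prodWeight_μ (p : Params) (L : ℕ) :
    ∑ a : Fin L → Fin 2, prodWeight p.μ a = 1 := by
  rw [sum_prodWeight, Fin.sum_univ_two, p.μ_sum, one_pow]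

/-- The coordinates are independent, so the mean affinity of a fixed vector with a random one
factorizes. -/
theorem Params.sum_prodWeight_mul_Q (p : Params) {L : ℕ} (a : Fin L → Fin 2) :
    ∑ b, prodWeight p.μ b * p.Q a b = prodWeight p.Γ a := by
  simp only [prodWeight, Params.Q, ← Finset.prod_mul_distrib, p.Γ_eq]
  rw [Fintype.prod_sum]

theorem Params.attrLaw_singleton (p : Params) (a : Fin 2) :
    p.attrLaw {a} = ENNReal.ofReal (p.μ a) := by
  unfold Params.attrLaw
  fin_cases a <;> simp

/-- The unordered pair of two distinct nodes, listed increasingly. -/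
def edgeOf {u v : ℕ} (h : u ≠ v) : {e : ℕ × ℕ // e.1 < e.2} := ⟨(min u v, max u v), min_lt_max.2 h⟩

theorem extU_eq {Ω : Type*} (U : ℕ → ℕ → Ω → ℝ) {u v : ℕ} (h : u ≠ v) (ω : Ω) :
    extU U u v ω = U (edgeOf h).1.1 (edgeOf h).1.2 ω := by
  unfold extU edgeOf
  rcases h.lt_or_gt with h | h
  · simp [h, h.le]
  · simp [h, h.le, h.not_gt]

/-! ### Finite-dimensional laws of attributes and edge variables -/

section Sample

variable {p : Params} {Ω : Type*} [MeasurableSpace Ω] {P : Measure Ω}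
  {A : ℕ → ℕ → Ω → Fin 2} {U : ℕ → ℕ → Ω → ℝ}

theorem IsSample.measure_attr (hS : IsSample p P A U) {ι : Type*} [Fintype ι] {L : ℕ} {f : ι → ℕ}
    (hf : f.Injective) (b : ι → Fin L → Fin 2) :
    P {ω | ∀ i, attrVec A L (f i) ω = b i} = ENNReal.ofReal (∏ i, prodWeight p.μ (b i)) := by
  have hinj : Function.Injective (fun x : ι × Fin L => (f x.1, (x.2 : ℕ))) := by
    rintro ⟨i, l⟩ ⟨j, k⟩ h
    simp only [Prod.mk.injEq] at h
    exact Prod.ext (hf h.1) (Fin.ext h.2)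
  have key := (hS.iIndep_A.precomp hinj).measure_inter_preimage_eq_mul Finset.univ
    (sets := fun x => {b x.1 x.2}) (fun _ _ => measurableSet_singleton _)
  have hset : {ω | ∀ i, attrVec A L (f i) ω = b i} =
      ⋂ x ∈ (Finset.univ : Finset (ι × Fin L)),
        (fun ω => A (f x.1) x.2 ω) ⁻¹' {b x.1 x.2} := by
    ext ω
    simp [attrVec, funext_iff]
  rw [hset, key]
  have hone : ∀ x : ι × Fin L, P ((fun ω => A (f x.1) x.2 ω) ⁻¹' {b x.1 x.2}) =
      ENNReal.ofReal (p.μ (b x.1 x.2)) := fun x => by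
    rw [← p.attrLaw_singleton, ← (hS.law_A (f x.1) x.2).map_eq,
      Measure.map_apply (hS.measurable_A _ _) (measurableSet_singleton _)]
  simp only [hone]
  rw [← ENNReal.ofReal_prod_of_nonneg fun x _ => (p.μ_mem _).1.le, Fintype.prod_prod_type]
  rfl

theorem IsSample.measure_edge (hS : IsSample p P A U) {κ : Type*} [Fintype κ]
    {e : κ → {e : ℕ × ℕ // e.1 < e.2}} (he : e.Injective) {T : κ → Set ℝ}
    (hT : ∀ k, MeasurableSet (T k)) :
    P {ω | ∀ k, U (e k).1.1 (e k).1.2 ω ∈ T k} =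
      ENNReal.ofReal (∏ k, volume.real (Set.Ioo (0 : ℝ) 1 ∩ T k)) := by
  have key := (hS.iIndep_U.precomp he).measure_inter_preimage_eq_mul Finset.univ
    (sets := T) (fun k _ => hT k)
  have hset : {ω | ∀ k, U (e k).1.1 (e k).1.2 ω ∈ T k} =
      ⋂ k ∈ (Finset.univ : Finset κ), (fun ω => U (e k).1.1 (e k).1.2 ω) ⁻¹' T k := by
    ext ω
    simp
  rw [hset, key, ENNReal.ofReal_prod_of_nonneg fun _ _ => measureReal_nonneg]
  refine Finset.prod_congr rfl fun k _ => ?_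
  have := (hS.uniform_U (e k).1.1 (e k).1.2 (e k).2).measure_preimage (by simp) (by simp) (hT k)
  rw [ofReal_measureReal ((measure_mono Set.inter_subset_left).trans_lt (by simp)).ne]
  simpa using this

/-- All graph probabilities below reduce to this formula: the graph events are covered by finitely
many events of this form, so conditioning is replaced by a finite sum over attribute vectors. -/
theorem IsSample.measureReal_attr_edge (hS : IsSample p P A U) {ι κ : Type*} [Fintype ι]
    [Fintype κ] {L : ℕ} {f : ι → ℕ} (hf : f.Injective) (b : ι → Fin L → Fin 2)
    {e : κ → {e : ℕ × ℕ // e.1 < e.2}} (he : e.Injective) {T : κ → Set ℝ}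
    (hT : ∀ k, MeasurableSet (T k)) :
    P.real {ω | (∀ i, attrVec A L (f i) ω = b i) ∧ ∀ k, U (e k).1.1 (e k).1.2 ω ∈ T k} =
      (∏ i, prodWeight p.μ (b i)) * ∏ k, volume.real (Set.Ioo (0 : ℝ) 1 ∩ T k) := by
  have hs : MeasurableSet {x : ℕ × ℕ → Fin 2 | ∀ i, ∀ l : Fin L, x (f i, l) = b i l} := by
    have : {x : ℕ × ℕ → Fin 2 | ∀ i, ∀ l : Fin L, x (f i, l) = b i l} =
        ⋂ i, ⋂ l : Fin L, (fun x : ℕ × ℕ → Fin 2 => x (f i, l)) ⁻¹' {b i l} := by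
      ext x; simp
    rw [this]
    exact MeasurableSet.iInter fun i => MeasurableSet.iInter fun l =>
      measurable_pi_apply _ (measurableSet_singleton _)
  have ht : MeasurableSet {x : {e : ℕ × ℕ // e.1 < e.2} → ℝ | ∀ k, x (e k) ∈ T k} := by
    have : {x : {e : ℕ × ℕ // e.1 < e.2} → ℝ | ∀ k, x (e k) ∈ T k} =
        ⋂ k, (fun x : {e : ℕ × ℕ // e.1 < e.2} → ℝ => x (e k)) ⁻¹' T k := by
      ext x; simp
    rw [this]
    exact MeasurableSet.iInter fun k => measurable_pi_apply _ (hT k)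
  have key := hS.indep_collections.measure_inter_preimage_eq_mul _ _ hs ht
  have h1 : ((fun ω (i : ℕ × ℕ) => A i.1 i.2 ω) ⁻¹'
      {x | ∀ i, ∀ l : Fin L, x (f i, l) = b i l}) = {ω | ∀ i, attrVec A L (f i) ω = b i} := by
    ext ω; simp [attrVec, funext_iff]
  have h2 : ((fun ω (e : {e : ℕ × ℕ // e.1 < e.2}) => U e.1.1 e.1.2 ω) ⁻¹'
      {x | ∀ k, x (e k) ∈ T k}) = {ω | ∀ k, U (e k).1.1 (e k).1.2 ω ∈ T k} := rfl
  rw [h1, h2, hS.measure_attr hf, hS.measure_edge he hT] at key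
  have h3 : 0 ≤ ∏ i, prodWeight p.μ (b i) :=
    Finset.prod_nonneg fun i _ => prodWeight_nonneg (fun a => (p.μ_mem a).1.le) _
  rw [← ENNReal.ofReal_mul h3] at key
  rw [Measure.real, Set.ofPred_and, key, ENNReal.toReal_ofReal]
  exact mul_nonneg h3 (Finset.prod_nonneg fun _ _ => measureReal_nonneg)

theorem volume_real_Ioo_inter_Iic {x : ℝ} (hx : x ∈ Set.Icc (0 : ℝ) 1) :
    volume.real (Set.Ioo (0 : ℝ) 1 ∩ Set.Iic x) = x := by
  have h : volume.real (Set.Ioo (0 : ℝ) 1 ∩ Set.Iic x) =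
      volume.real (Set.Ioc (0 : ℝ) 1 ∩ Set.Iic x) :=
    measureReal_congr (Ioo_ae_eq_Ioc.inter (ae_eq_refl _))
  rw [h, Set.Ioc_inter_Iic,
    inf_eq_right.2 hx.2]
  simp [hx.1]

theorem volume_real_Ioo_inter_Ioi {x : ℝ} (hx : x ∈ Set.Icc (0 : ℝ) 1) :
    volume.real (Set.Ioo (0 : ℝ) 1 ∩ Set.Ioi x) = 1 - x := by
  have : Set.Ioo (0 : ℝ) 1 ∩ Set.Ioi x = Set.Ioo x 1 := by
    ext y
    simp only [Set.mem_inter_iff, Set.mem_Ioo, Set.mem_Ioi]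
    have := hx.1
    grind
  rw [this]
  simp [hx.2]

/-! ### Union bounds for isolated nodes -/

variable [IsProbabilityMeasure P]

/-- Given the vector `a` of `u`, the other `m` nodes fail to be adjacent to `u` independently, each
with probability `1 - prodWeight p.Γ a`. Only an upper bound is needed, so subadditivity suffices
and the graph events need not be shown measurable. -/
theorem IsSample.measureReal_isIsolated_le (hS : IsSample p P A U) {m L : ℕ} (u : Fin (m + 1)) :
    P.real {ω | (graph p A U (m + 1) L ω).IsIsolated u} ≤
      ∑ a : Fin L → Fin 2, prodWeight p.μ a * (1 - prodWeight p.Γ a) ^ m := by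
  have hne : ∀ i : Fin m, (u : ℕ) ≠ (u.succAbove i : ℕ) := fun i h =>
    Fin.succAbove_ne u i (Fin.ext h.symm)
  have hinj : Function.Injective fun i : Fin m => edgeOf (hne i) := by
    intro i j h
    simp only [edgeOf, Subtype.mk.injEq, Prod.mk.injEq] at h
    refine Fin.succAbove_right_injective (p := u) (Fin.ext ?_)
    have := hne i
    have := hne j
    omega
  let E : (Fin (m + 1) → Fin L → Fin 2) → Set Ω := fun b =>
    {ω | (∀ i : Fin (m + 1), attrVec A L i ω = b i) ∧
      ∀ i : Fin m, U (edgeOf (hne i)).1.1 (edgeOf (hne i)).1.2 ω ∈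
        Set.Ioi (p.Q (b u) (b (u.succAbove i)))}
  have hsub : {ω | (graph p A U (m + 1) L ω).IsIsolated u} ⊆ ⋃ b, E b := by
    intro ω hω
    refine Set.mem_iUnion.2 ⟨fun i => attrVec A L i ω, fun i => rfl, fun i => ?_⟩
    rw [← extU_eq U (hne i)]
    by_contra hcon
    exact hω (u.succAbove i) ⟨(Fin.succAbove_ne u i).symm, not_lt.1 hcon⟩
  calc P.real {ω | (graph p A U (m + 1) L ω).IsIsolated u}
      ≤ P.real (⋃ b, E b) := measureReal_mono hsub
    _ ≤ ∑ b, P.real (E b) := measureReal_iUnion_fintype_le _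
    _ = ∑ b : Fin (m + 1) → Fin L → Fin 2, (∏ i, prodWeight p.μ (b i)) *
          ∏ i : Fin m, (1 - p.Q (b u) (b (u.succAbove i))) := by
        refine Finset.sum_congr rfl fun b _ => ?_
        rw [hS.measureReal_attr_edge Fin.val_injective b hinj fun _ => measurableSet_Ioi]
        simp only [volume_real_Ioo_inter_Ioi (p.Q_mem _ _)]
    _ = ∑ x : (Fin L → Fin 2) × (Fin m → Fin L → Fin 2), prodWeight p.μ x.1 *
          ∏ i, (prodWeight p.μ (x.2 i) * (1 - p.Q x.1 (x.2 i))) := by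
        -- Separating the vector of `u` from the others lets the sum over the latter factor into an
        -- `m`-th power.
        rw [← (Fin.insertNthEquiv (fun _ => Fin L → Fin 2) u).sum_comp]
        refine Finset.sum_congr rfl fun x _ => ?_
        rw [Fin.prod_univ_succAbove _ u]
        simp [Finset.prod_mul_distrib, mul_assoc]
    _ = ∑ a : Fin L → Fin 2, prodWeight p.μ a * (1 - prodWeight p.Γ a) ^ m := by
        rw [Fintype.sum_prod_type]
        refine Finset.sum_congr rfl fun a _ => ?_
        dsimp only
        rw [← Finset.mul_sum, ← Fintype.sum_pow
          (fun c => prodWeight p.μ c * (1 - p.Q a c)) m]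
        simp only [mul_sub, mul_one, Finset.sum_sub_distrib, p.sum_prodWeight_μ,
          p.sum_prodWeight_mul_Q]

theorem IsSample.measureReal_attr_and_lAdj_le (hS : IsSample p P A U) {L u v : ℕ} (huv : u ≠ v)
    (s : Finset (Fin L → Fin 2)) :
    P.real {ω | attrVec A L u ω ∈ s ∧ LAdj p A U L u v ω} ≤
      ∑ a ∈ s, prodWeight p.μ a * prodWeight p.Γ a := by
  have hf : Function.Injective ![u, v] := by
    intro i j
    fin_cases i <;> fin_cases j <;> simp [huv, huv.symm]
  let E : (Fin L → Fin 2) → (Fin L → Fin 2) → Set Ω := fun a b =>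
    {ω | (∀ i, attrVec A L (![u, v] i) ω = ![a, b] i) ∧
      ∀ _ : Unit, U (edgeOf huv).1.1 (edgeOf huv).1.2 ω ∈ Set.Iic (p.Q a b)}
  have hsub : {ω | attrVec A L u ω ∈ s ∧ LAdj p A U L u v ω} ⊆ ⋃ a ∈ s, ⋃ b, E a b := by
    rintro ω ⟨h1, h2⟩
    simp only [Set.mem_iUnion]
    refine ⟨attrVec A L u ω, h1, attrVec A L v ω, ?_, fun _ => ?_⟩
    · intro i
      fin_cases i <;> rfl
    · rw [← extU_eq U huv]
      exact h2
  calc _ ≤ P.real (⋃ a ∈ s, ⋃ b, E a b) := measureReal_mono hsub (measure_ne_top _ _)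
    _ ≤ ∑ a ∈ s, ∑ b, P.real (E a b) := (measureReal_biUnion_finset_le _ _).trans
        (Finset.sum_le_sum fun a _ => measureReal_iUnion_fintype_le _)
    _ = ∑ a ∈ s, prodWeight p.μ a * prodWeight p.Γ a := by
        refine Finset.sum_congr rfl fun a _ => ?_
        rw [← p.sum_prodWeight_mul_Q, Finset.mul_sum]
        refine Finset.sum_congr rfl fun b _ => ?_
        rw [hS.measureReal_attr_edge hf _ (Function.injective_of_subsingleton _)
          fun _ => measurableSet_Iic]
        simp [volume_real_Ioo_inter_Iic (p.Q_mem _ _), mul_assoc]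

theorem IsSample.measureReal_forall_attr_notMem_le (hS : IsSample p P A U) (m : ℕ) {L : ℕ}
    (s : Finset (Fin L → Fin 2)) :
    P.real {ω | ∀ u < m, attrVec A L u ω ∉ s} ≤ (1 - ∑ a ∈ s, prodWeight p.μ a) ^ m := by
  -- The edge constraints are indexed by `Empty`, which specializes the joint formula to attributes
  -- alone.
  let E : (Fin m → Fin L → Fin 2) → Set Ω := fun b =>
    {ω | (∀ i : Fin m, attrVec A L i ω = b i) ∧
      ∀ k : Empty, U (Empty.elim k : {e : ℕ × ℕ // e.1 < e.2}).1.1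
        (Empty.elim k : {e : ℕ × ℕ // e.1 < e.2}).1.2 ω ∈ (Empty.elim k : Set ℝ)}
  have hsub : {ω | ∀ u < m, attrVec A L u ω ∉ s} ⊆
      ⋃ b ∈ Fintype.piFinset fun _ => sᶜ, E b := by
    intro ω hω
    simp only [Set.mem_iUnion]
    refine ⟨fun i => attrVec A L i ω, ?_, fun _ => rfl, fun k => k.elim⟩
    simp only [Fintype.mem_piFinset, Finset.mem_compl]
    exact fun i => hω i i.2
  calc _ ≤ P.real (⋃ b ∈ Fintype.piFinset fun _ => sᶜ, E b) := measureReal_mono hsub (measure_ne_top _ _)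
    _ ≤ ∑ b ∈ Fintype.piFinset fun _ => sᶜ, P.real (E b) := measureReal_biUnion_finset_le _ _
    _ = ∑ b ∈ Fintype.piFinset fun _ : Fin m => sᶜ, ∏ i, prodWeight p.μ (b i) := by
        refine Finset.sum_congr rfl fun b _ => ?_
        rw [hS.measureReal_attr_edge (e := fun k : Empty => k.elim) (T := fun k : Empty => k.elim)
          Fin.val_injective b (Function.injective_of_subsingleton _) (fun k => k.elim)]
        simp
    _ = (1 - ∑ a ∈ s, prodWeight p.μ a) ^ m := by
        rw [← Finset.sum_pow', ← p.sum_prodWeight_μ L, ← Finset.sum_compl_add_sum s]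
        ring

/-- Union bound for the existence of an isolated node. -/
theorem IsSample.one_sub_noIsolated_le (hS : IsSample p P A U) {m L : ℕ} :
    1 - P.real (noIsolated p A U (m + 1) L) ≤
      (m + 1) * ∑ a : Fin L → Fin 2, prodWeight p.μ a * (1 - prodWeight p.Γ a) ^ m := by
  have hcover : (Set.univ : Set Ω) ⊆ noIsolated p A U (m + 1) L ∪
      ⋃ u, {ω | (graph p A U (m + 1) L ω).IsIsolated u} := by
    intro ω _
    simp only [noIsolated, Set.mem_union, Set.mem_ofPred_eq, Set.mem_iUnion]
    grind
  have h1 := measureReal_mono (μ := P) hcover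
  rw [probReal_univ] at h1
  have h2 := measureReal_union_le (μ := P) (noIsolated p A U (m + 1) L)
    (⋃ u, {ω | (graph p A U (m + 1) L ω).IsIsolated u})
  have h3 := (measureReal_iUnion_fintype_le (μ := P)
    fun u => {ω | (graph p A U (m + 1) L ω).IsIsolated u}).trans
    (Finset.sum_le_sum fun u _ => hS.measureReal_isIsolated_le u)
  simp only [Finset.sum_const, Finset.card_univ, Fintype.card_fin, nsmul_eq_mul] at h3
  push_cast at h3
  linarith

/-- If there is no isolated node then, among the first `m` nodes, either none has its attribute
vector in `s`, or one that does has a neighbour. -/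
theorem IsSample.noIsolated_le (hS : IsSample p P A U) {m n L : ℕ} (hmn : m ≤ n)
    (s : Finset (Fin L → Fin 2)) :
    P.real (noIsolated p A U n L) ≤ (1 - ∑ a ∈ s, prodWeight p.μ a) ^ m +
      m * n * ∑ a ∈ s, prodWeight p.μ a * prodWeight p.Γ a := by
  have hcover : noIsolated p A U n L ⊆ {ω | ∀ u < m, attrVec A L u ω ∉ s} ∪
      ⋃ u ∈ Finset.range m, ⋃ v ∈ (Finset.range n).filter (u ≠ ·),
        {ω | attrVec A L u ω ∈ s ∧ LAdj p A U L u v ω} := by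
    intro ω hω
    by_cases h : ∀ u < m, attrVec A L u ω ∉ s
    · exact Or.inl h
    · right
      push Not at h
      obtain ⟨u, hu, hus⟩ := h
      have := hω ⟨u, hu.trans_le hmn⟩
      simp only [SimpleGraph.IsIsolated, not_forall, not_not] at this
      obtain ⟨v, hv⟩ := this
      simp only [Set.mem_iUnion]
      refine ⟨u, Finset.mem_range.2 hu, v, ?_, hus, hv.2⟩
      simp only [Finset.mem_filter, Finset.mem_range]
      exact ⟨v.2, fun h => hv.1 (Fin.ext h)⟩
  refine (measureReal_mono hcover).trans ((measureReal_union_le _ _).trans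
    (add_le_add (hS.measureReal_forall_attr_notMem_le m s) ?_))
  have hnn : 0 ≤ ∑ a ∈ s, prodWeight p.μ a * prodWeight p.Γ a := Finset.sum_nonneg fun a _ =>
    mul_nonneg (prodWeight_nonneg (fun a => (p.μ_mem a).1.le) _)
      (prodWeight_nonneg (fun a => (p.Γ_mem a).1.le) _)
  calc _ ≤ ∑ u ∈ Finset.range m, ∑ v ∈ (Finset.range n).filter (u ≠ ·),
        ∑ a ∈ s, prodWeight p.μ a * prodWeight p.Γ a :=
        (measureReal_biUnion_finset_le _ _).trans (Finset.sum_le_sum fun u _ =>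
          (measureReal_biUnion_finset_le _ _).trans (Finset.sum_le_sum fun v hv =>
            hS.measureReal_attr_and_lAdj_le (Finset.mem_filter.1 hv).2 s))
    _ ≤ ∑ u ∈ Finset.range m, ∑ v ∈ Finset.range n,
        ∑ a ∈ s, prodWeight p.μ a * prodWeight p.Γ a :=
        Finset.sum_le_sum fun u _ => Finset.sum_le_sum_of_subset_of_nonneg
          (Finset.filter_subset _ _) fun _ _ _ => hnn
    _ = _ := by simp [mul_assoc]

end Sample

/-! ### The rate function -/

/-- The exponential rate `ln G(z, x)`, extended continuously to `z ∈ {0, 1}`. -/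
noncomputable def rate (z x : ℝ) : ℝ :=
  Real.binEntropy z + z * Real.log x + (1 - z) * Real.log (1 - x)

theorem rate_eq (z x : ℝ) : rate z x =
    z * (Real.log x - Real.log z) + (1 - z) * (Real.log (1 - x) - Real.log (1 - z)) := by
  unfold rate Real.binEntropy
  rw [Real.log_inv, Real.log_inv]
  ring

theorem log_G {z x : ℝ} (hz : z ∈ Set.Ioo (0 : ℝ) 1) (hx : x ∈ Set.Ioo (0 : ℝ) 1) :
    Real.log (G z x) = rate z x := by
  have hz' := sub_pos.2 hz.2
  have hx' := sub_pos.2 hx.2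
  have h1 := div_pos hx.1 hz.1
  have h2 := div_pos hx' hz'
  rw [G, Real.log_mul (Real.rpow_pos_of_pos h1 _).ne' (Real.rpow_pos_of_pos h2 _).ne',
    Real.log_rpow h1, Real.log_rpow h2, Real.log_div hx.1.ne' hz.1.ne',
    Real.log_div hx'.ne' hz'.ne', rate_eq]

theorem rate_self (x : ℝ) : rate x x = 0 := by simp [rate_eq]

theorem rate_zero_left (x : ℝ) : rate 0 x = Real.log (1 - x) := by simp [rate]

theorem rate_one_sub (z x : ℝ) : rate (1 - z) (1 - x) = rate z x := by
  simp only [rate, Real.binEntropy_one_sub, sub_sub_cancel]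
  ring

theorem continuous_rate (x : ℝ) : Continuous fun z => rate z x := by
  unfold rate
  have := Real.binEntropy_continuous
  fun_prop

/-- The derivative is `(ln x - ln z) + (ln(1 - z) - ln(1 - x))`, where both differences are positive
for `0 < z < x`. -/
theorem strictMonoOn_rate {x : ℝ} (hx : x < 1) : StrictMonoOn (fun z => rate z x) (Set.Icc 0 x) := by
  refine strictMonoOn_of_deriv_pos (convex_Icc 0 x) (continuous_rate x).continuousOn fun z hz => ?_
  rw [interior_Icc] at hz
  have hd : HasDerivAt (fun z => rate z x) ((Real.log (1 - z) - Real.log z) + 1 * Real.log x +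
      (-1) * Real.log (1 - x)) z :=
    ((Real.hasDerivAt_binEntropy hz.1.ne' (hz.2.trans hx).ne).add
      ((hasDerivAt_id z).mul_const _)).add (((hasDerivAt_id z).const_sub 1).mul_const _)
  rw [hd.deriv]
  have h1 := Real.log_lt_log hz.1 hz.2
  have h2 := Real.log_lt_log (sub_pos.2 hx) (sub_lt_sub_left hz.2 1)
  linarith

theorem rate_neg_of_lt {z x : ℝ} (hz : 0 ≤ z) (hzx : z < x) (hx : x < 1) : rate z x < 0 := by
  rw [← rate_self x]
  exact strictMonoOn_rate hx ⟨hz, hzx.le⟩ ⟨hz.trans hzx.le, le_rfl⟩ hzx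

theorem rate_neg_of_gt {z x : ℝ} (hx : 0 < x) (hxz : x < z) (hz : z ≤ 1) : rate z x < 0 := by
  rw [← rate_one_sub]
  exact rate_neg_of_lt (sub_nonneg.2 hz) (sub_lt_sub_left hxz 1) (sub_lt_self 1 hx)

/-! ### Large deviations for the number of ones -/

/-- The number of ones of an attribute vector. -/
def ones {L : ℕ} (a : Fin L → Fin 2) : ℝ := ∑ l, ((a l : ℕ) : ℝ)

/-- A product weight depends on the vector only through its number of ones, and its logarithm is
affine in that number. Tail estimates therefore compare exponents, without binomial coefficients. -/
theorem prodWeight_eq_exp {c : Fin 2 → ℝ} (hc : ∀ i, 0 < c i) {L : ℕ} (a : Fin L → Fin 2) :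
    prodWeight c a = Real.exp (ones a * Real.log (c 1) + (L - ones a) * Real.log (c 0)) := by
  have h : ∀ i : Fin 2, c i =
      Real.exp ((i : ℕ) * Real.log (c 1) + (1 - (i : ℕ)) * Real.log (c 0)) := by
    intro i
    fin_cases i <;> simp [Real.exp_log (hc _)]
  rw [prodWeight, Finset.prod_congr rfl fun l _ => h (a l), ← Real.exp_sum]
  congr 1
  simp [ones, Finset.sum_add_distrib, ← Finset.sum_mul]

/-- The pmf of the Bernoulli law with parameter `x`. -/
def bern (x : ℝ) : Fin 2 → ℝ := ![1 - x, x]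

theorem bern_pos {x : ℝ} (hx : x ∈ Set.Ioo (0 : ℝ) 1) (i : Fin 2) : 0 < bern x i := by
  fin_cases i
  · exact sub_pos.2 hx.2
  · exact hx.1

theorem sum_prodWeight_bern (x : ℝ) (L : ℕ) :
    ∑ a : Fin L → Fin 2, prodWeight (bern x) a = 1 := by
  simp [sum_prodWeight, bern]

theorem sum_prodWeight_bern_le_one {x : ℝ} (hx : x ∈ Set.Ioo (0 : ℝ) 1) {L : ℕ}
    (s : Finset (Fin L → Fin 2)) : ∑ a ∈ s, prodWeight (bern x) a ≤ 1 :=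
  (Finset.sum_le_univ_sum_of_nonneg fun a => prodWeight_nonneg (fun i => (bern_pos hx i).le) a).trans
    (sum_prodWeight_bern x L).le

theorem Params.μ_eq_bern (p : Params) : p.μ = bern (p.μ 1) := by
  ext i
  fin_cases i
  · exact eq_sub_of_add_eq p.μ_sum
  · rfl

/-- Change of measure between two Bernoulli product laws. -/
theorem prodWeight_bern_tilt {x z : ℝ} (hx : x ∈ Set.Ioo (0 : ℝ) 1) (hz : z ∈ Set.Ioo (0 : ℝ) 1)
    {L : ℕ} (a : Fin L → Fin 2) :
    prodWeight (bern x) a = Real.exp (ones a * (Real.log x - Real.log z) +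
      (L - ones a) * (Real.log (1 - x) - Real.log (1 - z))) * prodWeight (bern z) a := by
  rw [prodWeight_eq_exp (bern_pos hx), prodWeight_eq_exp (bern_pos hz), ← Real.exp_add]
  congr 1
  simp only [bern, Matrix.cons_val_zero, Matrix.cons_val_one]
  ring

/-- Chernoff's bound, for both tails. -/
theorem sum_prodWeight_bern_le_exp {x z : ℝ} (hx : x ∈ Set.Ioo (0 : ℝ) 1)
    (hz : z ∈ Set.Ioo (0 : ℝ) 1) {L : ℕ} {s : Finset (Fin L → Fin 2)}
    (hs : (z ≤ x ∧ ∀ a ∈ s, ones a ≤ z * L) ∨ (x ≤ z ∧ ∀ a ∈ s, z * L ≤ ones a)) :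
    ∑ a ∈ s, prodWeight (bern x) a ≤ Real.exp (L * rate z x) := by
  have hz' := sub_pos.2 hz.2
  have hx' := sub_pos.2 hx.2
  calc ∑ a ∈ s, prodWeight (bern x) a
      ≤ ∑ a ∈ s, Real.exp (L * rate z x) * prodWeight (bern z) a := by
        refine Finset.sum_le_sum fun a ha => ?_
        rw [prodWeight_bern_tilt hx hz]
        refine mul_le_mul_of_nonneg_right (Real.exp_le_exp.2 ?_)
          (prodWeight_nonneg (fun i => (bern_pos hz i).le) a)
        -- The tilting exponent is affine in `ones a` and equals `L * rate z x` at `ones a = z * L`.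
        -- In either tail, the sign of its slope makes this the maximum over `s`.
        have key : (ones a - z * L) * ((Real.log x - Real.log z) -
            (Real.log (1 - x) - Real.log (1 - z))) ≤ 0 := by
          rcases hs with ⟨h, hs⟩ | ⟨h, hs⟩
          · have h1 := Real.log_le_log hz.1 h
            have h2 := Real.log_le_log hx' (sub_le_sub_left h 1)
            exact mul_nonpos_of_nonpos_of_nonneg (by linarith [hs a ha]) (by linarith)
          · have h1 := Real.log_le_log hx.1 h
            have h2 := Real.log_le_log hz' (sub_le_sub_left h 1)
            exact mul_nonpos_of_nonneg_of_nonpos (by linarith [hs a ha]) (by linarith)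
        rw [rate_eq]
        linarith
    _ = Real.exp (L * rate z x) * ∑ a ∈ s, prodWeight (bern z) a := (Finset.mul_sum _ _ _).symm
    _ ≤ Real.exp (L * rate z x) * 1 :=
        mul_le_mul_of_nonneg_left (sum_prodWeight_bern_le_one hz s) (Real.exp_pos _).le
    _ = _ := mul_one _

/-- A lower bound for the lower tail, through the tilted law with parameter `y`. -/
theorem eventually_exp_div_two_le_sum {x y δ : ℝ} (hy : 0 < y) (hyx : y < x) (hx : x < 1)
    (hδ : 0 < δ) (hδy : δ < y) (hδ1 : y + δ < 1) :
    ∀ᶠ L : ℕ in atTop,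
      Real.exp (L * ((y - δ) * (Real.log x - Real.log y) +
        (1 - (y - δ)) * (Real.log (1 - x) - Real.log (1 - y)))) / 2 ≤
      ∑ a : Fin L → Fin 2 with ones a ≤ (y + δ) * L, prodWeight (bern x) a := by
  have hxm : x ∈ Set.Ioo (0 : ℝ) 1 := ⟨hy.trans hyx, hx⟩
  have hym : y ∈ Set.Ioo (0 : ℝ) 1 := ⟨hy, hyx.trans hx⟩
  -- Each tail of the tilted law eventually has mass below `1/4`, which leaves at least `1/2` in the
  -- window of half-width `δ` around `y`.
  have hlim : ∀ r : ℝ, r < 0 → ∀ᶠ L : ℕ in atTop, Real.exp (L * r) < 1 / 4 := fun r hr =>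
    (Real.tendsto_exp_atBot.comp
      (tendsto_natCast_atTop_atTop.atTop_mul_const_of_neg hr)).eventually_lt_const (by norm_num)
  filter_upwards [hlim _ (rate_neg_of_lt (sub_nonneg.2 hδy.le) (sub_lt_self y hδ) hym.2),
    hlim _ (rate_neg_of_gt hy (lt_add_of_pos_right y hδ) hδ1.le)] with L h1 h2
  -- Since `y < x`, the tilting exponent increases with the number of ones, so its minimum over the
  -- window is bounded below by its value `L * κ` at the lower edge `(y - δ) * L`.
  set κ := (y - δ) * (Real.log x - Real.log y) +
    (1 - (y - δ)) * (Real.log (1 - x) - Real.log (1 - y)) with hκ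
  set s : Finset (Fin L → Fin 2) := {a | (y - δ) * L ≤ ones a ∧ ones a ≤ (y + δ) * L} with hs
  set s₁ : Finset (Fin L → Fin 2) := {a | ones a ≤ (y - δ) * L} with hs₁
  set s₂ : Finset (Fin L → Fin 2) := {a | (y + δ) * L ≤ ones a} with hs₂
  have hpos : ∀ {w : ℝ}, w ∈ Set.Ioo (0 : ℝ) 1 → ∀ a : Fin L → Fin 2, 0 ≤ prodWeight (bern w) a :=
    fun hw => prodWeight_nonneg fun i => (bern_pos hw i).le
  have hmid : 1 / 2 ≤ ∑ a ∈ s, prodWeight (bern y) a := by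
    have e1 : ∑ a ∈ s₁, prodWeight (bern y) a ≤ Real.exp (L * rate (y - δ) y) :=
      sum_prodWeight_bern_le_exp hym ⟨sub_pos.2 hδy, by linarith⟩
        (Or.inl ⟨by linarith, by simp [hs₁]⟩)
    have e2 : ∑ a ∈ s₂, prodWeight (bern y) a ≤ Real.exp (L * rate (y + δ) y) :=
      sum_prodWeight_bern_le_exp hym ⟨by linarith, hδ1⟩ (Or.inr ⟨by linarith, by simp [hs₂]⟩)
    have e3 : (1 : ℝ) ≤ ∑ a ∈ s, prodWeight (bern y) a +
        (∑ a ∈ s₁, prodWeight (bern y) a + ∑ a ∈ s₂, prodWeight (bern y) a) := by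
      rw [← sum_prodWeight_bern y L]
      simp only [hs, hs₁, hs₂, Finset.sum_filter, ← Finset.sum_add_distrib]
      refine Finset.sum_le_sum fun a _ => ?_
      have := hpos hym a
      split_ifs <;> grind
    linarith
  calc Real.exp (L * κ) / 2 ≤ Real.exp (L * κ) * ∑ a ∈ s, prodWeight (bern y) a := by
        have := mul_le_mul_of_nonneg_left hmid (Real.exp_pos (L * κ)).le
        linarith
    _ = ∑ a ∈ s, Real.exp (L * κ) * prodWeight (bern y) a := Finset.mul_sum _ _ _
    _ ≤ ∑ a ∈ s, prodWeight (bern x) a := by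
        refine Finset.sum_le_sum fun a ha => ?_
        rw [prodWeight_bern_tilt hxm hym]
        refine mul_le_mul_of_nonneg_right (Real.exp_le_exp.2 ?_) (hpos hym a)
        have hl1 := Real.log_lt_log hy hyx
        have hl2 := Real.log_lt_log (sub_pos.2 hx) (sub_lt_sub_left hyx 1)
        have := mul_nonneg (sub_nonneg.2 (Finset.mem_filter.1 ha).2.1)
          (show 0 ≤ (Real.log x - Real.log y) - (Real.log (1 - x) - Real.log (1 - y)) by linarith)
        rw [hκ]
        linarith
    _ ≤ _ := Finset.sum_le_sum_of_subset_of_nonneg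
        (fun a ha => by
          simp only [hs, Finset.mem_filter] at ha ⊢
          exact ⟨ha.1, ha.2.2⟩) fun a _ _ => hpos hxm a

/-! ### The critical fraction of ones and the mean-degree exponent -/

/-- Existence and uniqueness of `ν⋆(ρ)`. -/
theorem existsUnique_isNuStar (p : Params) {ρ : ℝ} (hρ : 0 < ρ)
    (hμ : 1 + ρ * Real.log (p.μ 0) < 0) : ∃! ν : ℝ, IsNuStar p ρ ν := by
  have hm := p.μ_mem 1
  have hμ0 : p.μ 0 = 1 - p.μ 1 := eq_sub_of_add_eq p.μ_sum
  have hG : ∀ ν ∈ Set.Ioo 0 (p.μ 1), Real.log (G ν (p.μ 1)) = rate ν (p.μ 1) := fun ν hν =>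
    log_G ⟨hν.1, hν.2.trans hm.2⟩ hm
  have hcont : ContinuousOn (fun ν => 1 + ρ * rate ν (p.μ 1)) (Set.Icc 0 (p.μ 1)) :=
    (continuous_const.add (continuous_const.mul (continuous_rate _))).continuousOn
  -- The endpoint values are `1 + ρ ln μ(0) < 0` at `0` and `1` at `μ(1)`.
  obtain ⟨ν, hν, h0⟩ := intermediate_value_Ioo hm.1.le hcont
    (show (0 : ℝ) ∈ Set.Ioo _ _ by
      simp only [rate_zero_left, rate_self, ← hμ0]
      exact ⟨hμ, by norm_num⟩)
  refine ⟨ν, ⟨hν, by rw [hG ν hν]; exact h0⟩, fun ν' ⟨hν', h'⟩ => ?_⟩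
  rw [hG ν' hν'] at h'
  refine (strictMonoOn_rate hm.2).injOn (Set.Ioo_subset_Icc_self hν')
    (Set.Ioo_subset_Icc_self hν) (mul_left_cancel₀ hρ.ne' ?_)
  dsimp only at h0 ⊢
  linarith

/-- `ln (Γ(1) ^ z * Γ(0) ^ (1 - z))`. -/
noncomputable def Params.logΓ (p : Params) (z : ℝ) : ℝ :=
  z * Real.log (p.Γ 1) + (1 - z) * Real.log (p.Γ 0)

theorem Params.log_rpow_Γ (p : Params) (z : ℝ) :
    Real.log (p.Γ 1 ^ z * p.Γ 0 ^ (1 - z)) = p.logΓ z := by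
  have h0 := (p.Γ_mem 0).1
  have h1 := (p.Γ_mem 1).1
  rw [Real.log_mul (Real.rpow_pos_of_pos h1 _).ne' (Real.rpow_pos_of_pos h0 _).ne',
    Real.log_rpow h1, Real.log_rpow h0, Params.logΓ]

theorem Params.continuous_logΓ (p : Params) : Continuous p.logΓ := by
  unfold Params.logΓ
  fun_prop

theorem Params.logΓ_neg (p : Params) {z : ℝ} (hz : z ∈ Set.Ioo (0 : ℝ) 1) : p.logΓ z < 0 :=
  add_neg (mul_neg_of_pos_of_neg hz.1 (Real.log_neg (p.Γ_mem 1).1 (p.Γ_mem 1).2))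
    (mul_neg_of_pos_of_neg (sub_pos.2 hz.2) (Real.log_neg (p.Γ_mem 0).1 (p.Γ_mem 0).2))

/-- Because `Γ(0) < Γ(1)`, the weight increases with the number of ones, so it is compared with its
value at `z * L` ones. -/
theorem Params.prodWeight_Γ_le (p : Params) (hΓ : p.Γ 0 < p.Γ 1) {L : ℕ} {z : ℝ}
    {a : Fin L → Fin 2} (ha : ones a ≤ z * L) : prodWeight p.Γ a ≤ Real.exp (L * p.logΓ z) := by
  rw [prodWeight_eq_exp fun i => (p.Γ_mem i).1, Real.exp_le_exp]
  have := mul_nonneg (sub_nonneg.2 ha)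
    (sub_nonneg.2 (Real.log_le_log (p.Γ_mem 0).1 hΓ.le))
  unfold Params.logΓ
  linarith

theorem Params.le_prodWeight_Γ (p : Params) (hΓ : p.Γ 0 < p.Γ 1) {L : ℕ} {z : ℝ}
    {a : Fin L → Fin 2} (ha : z * L ≤ ones a) : Real.exp (L * p.logΓ z) ≤ prodWeight p.Γ a := by
  rw [prodWeight_eq_exp fun i => (p.Γ_mem i).1, Real.exp_le_exp]
  have := mul_nonneg (sub_nonneg.2 ha)
    (sub_nonneg.2 (Real.log_le_log (p.Γ_mem 0).1 hΓ.le))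
  unfold Params.logΓ
  linarith

/-! ### Asymptotics under an admissible scaling -/

theorem tendsto_log_natCast_atTop : Tendsto (fun n : ℕ => Real.log n) atTop atTop :=
  Real.tendsto_log_atTop.comp tendsto_natCast_atTop_atTop

theorem IsAdmissible.tendsto_div_log {ρ : ℝ} (hρ : 0 < ρ) {L : ℕ → ℕ} (hL : IsAdmissible ρ L) :
    Tendsto (fun n => (L n : ℝ) / Real.log n) atTop (𝓝 ρ) := by
  have hpos := tendsto_log_natCast_atTop.eventually_gt_atTop 0
  have h := ((isEquivalent_iff_tendsto_one
    (hpos.mono fun n hn => (mul_pos hρ hn).ne')).1 hL.equiv).const_mul ρ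
  rw [mul_one] at h
  refine h.congr' (hpos.mono fun n hn => ?_)
  simp only [Pi.div_apply]
  field_simp

theorem IsAdmissible.tendsto_atTop {ρ : ℝ} (hρ : 0 < ρ) {L : ℕ → ℕ} (hL : IsAdmissible ρ L) :
    Tendsto L atTop atTop := by
  refine tendsto_natCast_atTop_iff.1 (hL.equiv.symm.tendsto_atTop
    (tendsto_log_natCast_atTop.const_mul_atTop hρ))

/-- This says `n * exp(L n * κ) = n^(1 + ρκ + o(1))`; the two bounds that follow turn strict
inequalities on `1 + ρκ` into bounds by powers of `n`. -/
theorem IsAdmissible.tendsto_one_add_mul {ρ : ℝ} (hρ : 0 < ρ) {L : ℕ → ℕ}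
    (hL : IsAdmissible ρ L) (κ : ℝ) :
    Tendsto (fun n : ℕ => (Real.log n + L n * κ) / Real.log n) atTop (𝓝 (1 + ρ * κ)) := by
  refine (((hL.tendsto_div_log hρ).mul_const κ).const_add 1).congr'
    ((tendsto_log_natCast_atTop.eventually_gt_atTop 0).mono fun n hn => ?_)
  field_simp

theorem IsAdmissible.eventually_le {ρ : ℝ} (hρ : 0 < ρ) {L : ℕ → ℕ} (hL : IsAdmissible ρ L)
    {κ c : ℝ} (h : 1 + ρ * κ < c) : ∀ᶠ n : ℕ in atTop, Real.log n + L n * κ ≤ c * Real.log n := by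
  filter_upwards [(hL.tendsto_one_add_mul hρ κ).eventually_lt_const h,
    tendsto_log_natCast_atTop.eventually_gt_atTop 0] with n h1 hn
  exact ((div_lt_iff₀ hn).1 h1).le

theorem IsAdmissible.eventually_ge {ρ : ℝ} (hρ : 0 < ρ) {L : ℕ → ℕ} (hL : IsAdmissible ρ L)
    {κ c : ℝ} (h : c < 1 + ρ * κ) : ∀ᶠ n : ℕ in atTop, c * Real.log n ≤ Real.log n + L n * κ := by
  filter_upwards [(hL.tendsto_one_add_mul hρ κ).eventually_const_lt h,
    tendsto_log_natCast_atTop.eventually_gt_atTop 0] with n h1 hn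
  exact ((lt_div_iff₀ hn).1 h1).le

/-- With `t = ln n` this gives `n * exp(1 - n^c) → 0`. The quadratic lower bound for the exponential
leaves at most `t * (1 - c^2 / 2 * t)`. -/
theorem tendsto_add_one_sub_exp_atBot {c : ℝ} (hc : 0 < c) :
    Tendsto (fun t : ℝ => t + 1 - Real.exp (c * t)) atTop atBot := by
  have hlin : Tendsto (fun t : ℝ => 1 - c ^ 2 / 2 * t) atTop atBot :=
    tendsto_atBot_add_const_left _ 1
      (tendsto_neg_atTop_atBot.comp (tendsto_id.const_mul_atTop (by positivity : 0 < c ^ 2 / 2)))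
  refine tendsto_atBot_mono' _ ?_ (tendsto_id.atTop_mul_atBot₀ hlin)
  filter_upwards [eventually_ge_atTop 0] with t ht
  have h1 := Real.quadratic_le_exp_of_nonneg (mul_nonneg hc.le ht)
  have h2 := mul_nonneg hc.le ht
  simp only [id]
  linarith

/-! ### The one-law and the zero-law -/

section Sample

variable {p : Params} {Ω : Type*} [MeasurableSpace Ω] {P : Measure Ω} [IsProbabilityMeasure P]
  {A : ℕ → ℕ → Ω → Fin 2} {U : ℕ → ℕ → Ω → ℝ}

/-- The union bound is split at `z * L` ones. Vectors below are controlled by their total mass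
(Chernoff), those above by `(1 - x)^m ≤ exp(-m * x)` with `x = exp(L * p.logΓ z)`. -/
theorem IsSample.one_sub_noIsolated_le_exp (hS : IsSample p P A U) (hΓ : p.Γ 0 < p.Γ 1) {z : ℝ}
    (hz : z ∈ Set.Ioo 0 (p.μ 1)) {n : ℕ} (hn : 1 ≤ n) (L : ℕ) :
    1 - P.real (noIsolated p A U n L) ≤ Real.exp (Real.log n + L * rate z (p.μ 1)) +
      Real.exp (Real.log n + 1 - Real.exp (Real.log n + L * p.logΓ z)) := by
  have hm := p.μ_mem 1
  have hz1 : z ∈ Set.Ioo (0 : ℝ) 1 := ⟨hz.1, hz.2.trans hm.2⟩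
  obtain ⟨m, rfl⟩ := Nat.exists_eq_add_of_le' hn
  have hn0 : (0 : ℝ) < ((m + 1 : ℕ) : ℝ) := by positivity
  have hw : ∀ a : Fin L → Fin 2, 0 ≤ prodWeight p.μ a := prodWeight_nonneg fun i => (p.μ_mem i).1.le
  have hg0 : ∀ a : Fin L → Fin 2, 0 ≤ prodWeight p.Γ a := prodWeight_nonneg fun i => (p.Γ_mem i).1.le
  have hg1 : ∀ a : Fin L → Fin 2, prodWeight p.Γ a ≤ 1 := fun a =>
    Finset.prod_le_one (fun _ _ => (p.Γ_mem _).1.le) fun _ _ => (p.Γ_mem _).2.le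
  set s : Finset (Fin L → Fin 2) := {a | ones a ≤ z * L} with hs
  have hlow : ∑ a ∈ s, prodWeight p.μ a ≤ Real.exp (L * rate z (p.μ 1)) := by
    rw [p.μ_eq_bern]
    exact sum_prodWeight_bern_le_exp hm hz1 (Or.inl ⟨hz.2.le, by simp [hs]⟩)
  -- A node has `m = n - 1` potential neighbours. Replacing `m` by `n` in the exponent costs at most
  -- a factor `e`, since `exp(L * p.logΓ z) ≤ 1`; this is the `+ 1` in the bound.
  have hpow : (m + 1 : ℝ) * Real.exp (-(m * Real.exp (L * p.logΓ z))) ≤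
      Real.exp (Real.log ((m + 1 : ℕ) : ℝ) + 1 -
        Real.exp (Real.log ((m + 1 : ℕ) : ℝ) + L * p.logΓ z)) := by
    have h1 : Real.exp (L * p.logΓ z) ≤ 1 := Real.exp_le_one_iff.2
      (mul_nonpos_of_nonneg_of_nonpos L.cast_nonneg (p.logΓ_neg hz1).le)
    rw [add_sub_assoc, Real.exp_add _ (1 - _), Real.exp_add _ (_ * _), Real.exp_log hn0]
    push_cast
    gcongr
    linarith
  calc 1 - P.real (noIsolated p A U (m + 1) L)
      ≤ (m + 1) * ∑ a : Fin L → Fin 2, prodWeight p.μ a * (1 - prodWeight p.Γ a) ^ m :=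
        hS.one_sub_noIsolated_le
    _ ≤ (m + 1) * (∑ a ∈ s, prodWeight p.μ a + ∑ a ∈ sᶜ, prodWeight p.μ a *
          Real.exp (-(m * Real.exp (L * p.logΓ z)))) := by
        rw [← Finset.sum_add_sum_compl s]
        gcongr with a _ a ha
        · exact mul_le_of_le_one_right (hw a)
            (pow_le_one₀ (sub_nonneg.2 (hg1 a)) (sub_le_self _ (hg0 a)))
        · exact hw a
        · have hle := p.le_prodWeight_Γ hΓ (z := z) (a := a) (by
            simp only [hs, Finset.mem_compl, Finset.mem_filter_univ, not_le] at ha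
            exact ha.le)
          calc (1 - prodWeight p.Γ a) ^ m ≤ Real.exp (-Real.exp (L * p.logΓ z)) ^ m := by
                refine pow_le_pow_left₀ (sub_nonneg.2 (hg1 a)) ?_ m
                exact (sub_le_sub_left hle 1).trans (Real.one_sub_le_exp_neg _)
            _ = _ := by rw [← Real.exp_nat_mul, mul_neg]
    _ ≤ (m + 1) * (Real.exp (L * rate z (p.μ 1)) +
          1 * Real.exp (-(m * Real.exp (L * p.logΓ z)))) := by
        rw [← Finset.sum_mul]
        gcongr
        rw [p.μ_eq_bern]
        exact sum_prodWeight_bern_le_one hm _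
    _ ≤ _ := by
        rw [one_mul, mul_add, Real.exp_add, Real.exp_log hn0]
        push_cast at hpow ⊢
        linarith

/-- The one-law. -/
theorem IsSample.tendsto_noIsolated_one (hS : IsSample p P A U) (hΓ : p.Γ 0 < p.Γ 1) {ρ z : ℝ}
    (hρ : 0 < ρ) (hz : z ∈ Set.Ioo 0 (p.μ 1)) (hrate : 1 + ρ * rate z (p.μ 1) < 0)
    (hlog : 0 < 1 + ρ * p.logΓ z) {L : ℕ → ℕ} (hL : IsAdmissible ρ L) :
    Tendsto (fun n : ℕ => P.real (noIsolated p A U n (L n))) atTop (𝓝 1) := by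
  obtain ⟨b, hb1, hb0⟩ := exists_between hrate
  obtain ⟨c, hc0, hc1⟩ := exists_between hlog
  have hlim : Tendsto (fun n : ℕ => Real.exp (b * Real.log n) +
      Real.exp (Real.log n + 1 - Real.exp (c * Real.log n))) atTop (𝓝 0) := by
    rw [← add_zero (0 : ℝ)]
    exact (Real.tendsto_exp_atBot.comp
      (tendsto_log_natCast_atTop.const_mul_atTop_of_neg hb0)).add (Real.tendsto_exp_atBot.comp
      ((tendsto_add_one_sub_exp_atBot hc0).comp tendsto_log_natCast_atTop))
  have hlow := hlim.const_sub 1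
  rw [sub_zero] at hlow
  refine tendsto_of_tendsto_of_tendsto_of_le_of_le' hlow tendsto_const_nhds ?_
    (Eventually.of_forall fun n => measureReal_le_one)
  filter_upwards [hL.eventually_le hρ hb1, hL.eventually_ge hρ hc1, eventually_ge_atTop 1]
    with n h1 h2 hn
  have h3 := hS.one_sub_noIsolated_le_exp hΓ hz hn (L n)
  have h4 := Real.exp_le_exp.2 h1
  have h5 : Real.exp (Real.log n + 1 - Real.exp (Real.log n + L n * p.logΓ z)) ≤
      Real.exp (Real.log n + 1 - Real.exp (c * Real.log n)) :=
    Real.exp_le_exp.2 (sub_le_sub_left (Real.exp_le_exp.2 h2) _)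
  linarith

/-- The zero-law. -/
theorem IsSample.tendsto_noIsolated_zero (hS : IsSample p P A U) (hΓ : p.Γ 0 < p.Γ 1) {ρ z κ : ℝ}
    (hρ : 0 < ρ) (htail : ∀ᶠ L : ℕ in atTop, Real.exp (L * κ) / 2 ≤
      ∑ a : Fin L → Fin 2 with ones a ≤ z * L, prodWeight p.μ a)
    (hκ : 0 < 1 + ρ * κ) (hlog : 1 + ρ * p.logΓ z < 0) {L : ℕ → ℕ} (hL : IsAdmissible ρ L) :
    Tendsto (fun n : ℕ => P.real (noIsolated p A U n (L n))) atTop (𝓝 0) := by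
  -- The margin `2 * c` makes room for `t = n^c`: eventually `n * exp(L n * κ) ≥ t^2` and `n * exp(L
  -- n * p.logΓ z) ≤ t^(-2)`.
  obtain ⟨c, hc0, hc⟩ : ∃ c, 0 < c ∧ 2 * c < min (1 + ρ * κ) (-(1 + ρ * p.logΓ z)) := by
    obtain ⟨d, hd0, hd⟩ := exists_between (lt_min hκ (neg_pos.2 hlog))
    exact ⟨d / 2, half_pos hd0, by linarith⟩
  have hc1 : 2 * c < 1 + ρ * κ := hc.trans_le (min_le_left _ _)
  have hc2 : 1 + ρ * p.logΓ z < -(2 * c) := lt_neg.1 (hc.trans_le (min_le_right _ _))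
  have hexp : Tendsto (fun n : ℕ => Real.exp (c * Real.log n)) atTop atTop :=
    Real.tendsto_exp_atTop.comp (tendsto_log_natCast_atTop.const_mul_atTop hc0)
  have hlim : Tendsto (fun n : ℕ => Real.exp (-Real.exp (c * Real.log n)) +
      2 * (Real.exp (c * Real.log n))⁻¹) atTop (𝓝 0) := by
    simpa using (Real.tendsto_exp_neg_atTop_nhds_zero.comp hexp).add
      (hexp.inv_tendsto_atTop.const_mul 2)
  refine tendsto_of_tendsto_of_tendsto_of_le_of_le' tendsto_const_nhds hlim
    (Eventually.of_forall fun n => measureReal_nonneg) ?_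
  filter_upwards [hL.eventually_ge hρ hc1, hL.eventually_le hρ hc2,
    (hL.tendsto_atTop hρ).eventually htail, hexp.eventually_ge_atTop 2, eventually_ge_atTop 1]
    with n h1 h2 h3 h4 hn
  have hn0 : (0 : ℝ) < n := by exact_mod_cast hn
  set s : Finset (Fin (L n) → Fin 2) := {a | ones a ≤ z * L n} with hs
  set w := ∑ a ∈ s, prodWeight p.μ a with hw
  set t := Real.exp (c * Real.log n) with ht
  have hw0 : 0 < w := (half_pos (Real.exp_pos _)).trans_le h3
  have hw1 : w ≤ 1 := by
    rw [hw, p.μ_eq_bern]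
    exact sum_prodWeight_bern_le_one (p.μ_mem 1) s
  have hnκ : t * t ≤ n * Real.exp (L n * κ) := by
    rw [ht, ← Real.exp_add]
    calc _ ≤ Real.exp (Real.log n + L n * κ) := Real.exp_le_exp.2 (by linarith)
      _ = _ := by rw [Real.exp_add, Real.exp_log hn0]
  have hnΓ : n * Real.exp (L n * p.logΓ z) ≤ (t * t)⁻¹ := by
    rw [ht, ← Real.exp_add, ← Real.exp_neg]
    calc _ = Real.exp (Real.log n + L n * p.logΓ z) := by rw [Real.exp_add, Real.exp_log hn0]
      _ ≤ _ := Real.exp_le_exp.2 (by linarith)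
  -- With `m = ⌈t / w⌉₊` inspected nodes, the expected number `m * w` of those with vector in `s`
  -- lies between `t` and `2 * t`. None occurs with probability at most `exp(-t)`, and the expected
  -- number of their neighbours is at most `2 * t * t^(-2)`.
  have hm1 : t / w ≤ ⌈t / w⌉₊ := Nat.le_ceil _
  have hm2 : (⌈t / w⌉₊ : ℝ) < t / w + 1 := Nat.ceil_lt_add_one (by positivity)
  have hmn : ⌈t / w⌉₊ ≤ n := by
    refine Nat.ceil_le.2 ((div_le_iff₀ hw0).2 ?_)
    -- Here `t ≥ 2` absorbs the factor `1/2` of the tail bound.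
    calc t ≤ t * t / 2 := by nlinarith
      _ ≤ n * (Real.exp (L n * κ) / 2) := by linarith
      _ ≤ n * w := by gcongr
  have hmw : ⌈t / w⌉₊ * w ≤ 2 * t := by
    calc ⌈t / w⌉₊ * w ≤ (t / w + 1) * w := by gcongr
      _ = t + w := by field_simp
      _ ≤ 2 * t := by linarith
  have hpow : (1 - w) ^ ⌈t / w⌉₊ ≤ Real.exp (-t) := by
    calc (1 - w) ^ ⌈t / w⌉₊ ≤ Real.exp (-w) ^ ⌈t / w⌉₊ :=
          pow_le_pow_left₀ (sub_nonneg.2 hw1) (Real.one_sub_le_exp_neg _) _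
      _ = Real.exp (-(⌈t / w⌉₊ * w)) := by rw [← Real.exp_nat_mul, mul_neg]
      _ ≤ Real.exp (-t) := Real.exp_le_exp.2 (neg_le_neg ((div_le_iff₀ hw0).1 hm1))
  have hsum : ∑ a ∈ s, prodWeight p.μ a * prodWeight p.Γ a ≤ w * Real.exp (L n * p.logΓ z) := by
    rw [hw, Finset.sum_mul]
    refine Finset.sum_le_sum fun a ha => mul_le_mul_of_nonneg_left
      (p.prodWeight_Γ_le hΓ (by simpa [hs] using ha)) (prodWeight_nonneg (fun i => (p.μ_mem i).1.le) a)
  refine (hS.noIsolated_le hmn s).trans (add_le_add hpow ?_)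
  calc (⌈t / w⌉₊ : ℝ) * n * ∑ a ∈ s, prodWeight p.μ a * prodWeight p.Γ a
      ≤ ⌈t / w⌉₊ * n * (w * Real.exp (L n * p.logΓ z)) := by gcongr
    _ = (⌈t / w⌉₊ * w) * (n * Real.exp (L n * p.logΓ z)) := by ring
    _ ≤ (2 * t) * (t * t)⁻¹ := by gcongr
    _ = 2 * t⁻¹ := by field_simp

end Sample

end MAG

/-! ### Perturbation around the critical fraction -/

theorem theorem2 (p : MAG.Params) (hΓ : p.Γ 0 < p.Γ 1) (ρ : ℝ) (hρ : 0 < ρ)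
    (hμ : 1 + ρ * Real.log (p.μ 0) < 0)
    {Ω : Type*} [MeasurableSpace Ω] (P : Measure Ω) [IsProbabilityMeasure P]
    (A : ℕ → ℕ → Ω → Fin 2) (U : ℕ → ℕ → Ω → ℝ) (hS : MAG.IsSample p P A U) :
    (∃! ν : ℝ, MAG.IsNuStar p ρ ν) ∧
    ∀ ν : ℝ, MAG.IsNuStar p ρ ν →
      ∀ L : ℕ → ℕ, MAG.IsAdmissible ρ L →
        (1 + ρ * Real.log (p.Γ 1 ^ ν * p.Γ 0 ^ (1 - ν)) < 0 →
          Tendsto (fun n : ℕ => P.real (MAG.noIsolated p A U n (L n))) atTop (𝓝 0)) ∧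
        (0 < 1 + ρ * Real.log (p.Γ 1 ^ ν * p.Γ 0 ^ (1 - ν)) →
          Tendsto (fun n : ℕ => P.real (MAG.noIsolated p A U n (L n))) atTop (𝓝 1)) := by
  refine ⟨MAG.existsUnique_isNuStar p hρ hμ, fun ν ⟨hν, heq⟩ L hL => ?_⟩
  have hm := p.μ_mem 1
  rw [p.log_rpow_Γ]
  rw [MAG.log_G ⟨hν.1, hν.2.trans hm.2⟩ hm] at heq
  have hcΓ : Continuous fun z => 1 + ρ * p.logΓ z :=
    continuous_const.add (continuous_const.mul p.continuous_logΓ)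
  constructor
  · intro hneg
    -- Moving slightly above `ν` keeps the mean-degree exponent negative by continuity, and makes `1
    -- + ρ * rate` strictly positive by strict monotonicity.
    obtain ⟨y, hyΓ, hνy, hym⟩ := ((((hcΓ.tendsto ν).eventually_lt_const hneg).filter_mono
      nhdsWithin_le_nhds).and (Ioo_mem_nhdsGT hν.2)).exists
    have hy0 : 0 < y := hν.1.trans hνy
    have hy1 : y < 1 := hym.trans hm.2
    have hrate : 0 < 1 + ρ * MAG.rate y (p.μ 1) := by
      have := mul_lt_mul_of_pos_left
        (MAG.strictMonoOn_rate hm.2 ⟨hν.1.le, hν.2.le⟩ ⟨hy0.le, hym.le⟩ hνy) hρ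
      dsimp only at this
      linarith
    have hκ : Continuous fun δ : ℝ => 1 + ρ * ((y - δ) * (Real.log (p.μ 1) - Real.log y) +
        (1 - (y - δ)) * (Real.log (1 - p.μ 1) - Real.log (1 - y))) := by fun_prop
    have hΓ' : Continuous fun δ : ℝ => 1 + ρ * p.logΓ (y + δ) :=
      hcΓ.comp (continuous_const.add continuous_id)
    have e1 := (hκ.tendsto 0).eventually_const_lt (u := 0) (by
      rw [MAG.rate_eq] at hrate
      simpa only [sub_zero] using hrate)
    have e2 := (hΓ'.tendsto 0).eventually_lt_const (u := 0) (by simpa only [add_zero] using hyΓ)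
    -- At `δ = 0` the tilting exponent is `rate y (p.μ 1)`, so both strict inequalities survive for
    -- a small window `δ > 0`.
    obtain ⟨δ, ⟨h1, h2⟩, h0, hδ⟩ := (((e1.and e2).filter_mono nhdsWithin_le_nhds).and
      (Ioo_mem_nhdsGT (lt_min hy0 (sub_pos.2 hy1)))).exists
    have hδ1 := hδ.trans_le (min_le_left _ _)
    have hδ2 := hδ.trans_le (min_le_right _ _)
    refine hS.tendsto_noIsolated_zero hΓ hρ (z := y + δ) ?_ h1 h2 hL
    rw [p.μ_eq_bern]
    exact MAG.eventually_exp_div_two_le_sum hy0 hym hm.2 h0 hδ1 (by linarith)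
  · intro hpos
    -- Symmetrically, slightly below `ν` the rate condition becomes strictly negative while the
    -- mean-degree exponent stays positive.
    obtain ⟨z, hzΓ, hz0, hzν⟩ := ((((hcΓ.tendsto ν).eventually_const_lt hpos).filter_mono
      nhdsWithin_le_nhds).and (Ioo_mem_nhdsLT hν.1)).exists
    refine hS.tendsto_noIsolated_one hΓ hρ ⟨hz0, hzν.trans hν.2⟩ ?_ hzΓ hL
    have := mul_lt_mul_of_pos_left
      (MAG.strictMonoOn_rate hm.2 ⟨hz0.le, (hzν.trans hν.2).le⟩ ⟨hν.1.le, hν.2.le⟩ hzν) hρ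
    dsimp only at this
    linarith
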